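/- All graphs are simple and undirected, possibly infinite, and a graph class is a set $\mathcal C$ of graphs (not necessarily closed under isomorphism or under subgraphs). A finite nonempty graph has \emph{cliquewidth} at most $k$ if it can be constructed, up to isomorphism, using labels from a set of $k$ labels and the operations: create a single labelled vertex; take the disjoint union of two labelled graphs; add all edges between the vertices labelled $i$ and the vertices labelled $j$, where $i\neq j$; change every label $i$ into $j$. An arbitrary graph has cliquewidth at most $k$ if all its finite nonempty induced subgraphs do (for finite nonempty graphs this agrees with the previous sentence). A graph class $\mathcal C$ has \emph{bounded cliquewidth} if there is $k\in\mathbb N$ such that every $G\in\mathcal C$ has cliquewidth at most $k$. A \emph{$k$-flip} of a graph $G$ is a graph $H$ on the vertex set $V(G)$ for which there are a partition $\mathcal K$ of $V(G)$ into at most $k$ parts and a symmetric relation $F\subseteq\mathcal K^2$ such that distinct vertices $u\in X\in\mathcal K$ and $v\in Y\in\mathcal K$ are adjacent in $H$ if and only if either $(X,Y)\in F$ and $uv\notin E(G)$, or $(X,Y)\notin F$ and $uv\in E(G)$. A graph class $\mathcal C$ is \emph{distance-$\infty$ flip-breakable} if there exist a function $N:\mathbb N\to\mathbb N$ and a constant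 $k\in\mathbb N$ such that for all $m\in\mathbb N$, $G\in\mathcal C$ and $W\subseteq V(G)$ with $|W|\ge N(m)$ there exist subsets $A,B\subseteq W$ with $|A|,|B|\ge m$ and a $k$-flip $H$ of $G$ such that no two vertices $a\in A$ and $b\in B$ are in the same connected component of $H$. \textbf{Theorem.} A graph class has bounded cliquewidth if and only if it is distance-$\infty$ flip-breakable. -/

import Mathlib

universe u

/-! ### Cliquewidth -/

/-- Cliquewidth expressions (terms) with label set `Fin k`. -/
inductive CliqueExpr (k : ℕ) : Type
  /-- a single vertex labelled `i` -/
  | vertex (i : Fin k) : CliqueExpr k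
  /-- disjoint union -/
  | union (s t : CliqueExpr k) : CliqueExpr k
  /-- join every vertex labelled `i` to every vertex labelled `j`, where `i ≠ j` -/
  | join (i j : Fin k) (hij : i ≠ j) (t : CliqueExpr k) : CliqueExpr k
  /-- change every label `i` into `j` -/
  | relabel (i j : Fin k) (t : CliqueExpr k) : CliqueExpr k

namespace CliqueExpr

/-- The vertex set of the labelled graph defined by an expression. -/
def Vert {k : ℕ} : CliqueExpr k → Type
  | vertex _ => Unit
  | union s t => s.Vert ⊕ t.Vert
  | join _ _ _ t => t.Vert
  | relabel _ _ t => t.Vert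

/-- The labelling of the labelled graph defined by an expression. -/
def label {k : ℕ} : (t : CliqueExpr k) → t.Vert → Fin k
  | vertex i => fun _ => i
  | union s t => Sum.elim s.label t.label
  | join _ _ _ t => t.label
  | relabel i j t => fun v => if t.label v = i then j else t.label v

/-- The underlying graph of the labelled graph defined by an expression. -/
def graph {k : ℕ} : (t : CliqueExpr k) → SimpleGraph t.Vert
  | vertex _ => (⊥ : SimpleGraph Unit)
  | union s t => SimpleGraph.sum s.graph t.graph
  | join i j hij t =>
      { Adj := fun u v => t.graph.Adj u v ∨
          (t.label u = i ∧ t.label v = j) ∨ (t.label u = j ∧ t.label v = i)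
        symm := ⟨by
          rintro u v (h | ⟨h₁, h₂⟩ | ⟨h₁, h₂⟩)
          · exact Or.inl h.symm
          · exact Or.inr (Or.inr ⟨h₂, h₁⟩)
          · exact Or.inr (Or.inl ⟨h₂, h₁⟩)⟩
        loopless := ⟨by
          rintro u (h | ⟨h₁, h₂⟩ | ⟨h₁, h₂⟩)
          · exact t.graph.irrefl h
          · exact hij (h₁.symm.trans h₂)
          · exact hij (h₂.symm.trans h₁)⟩ }
  | relabel _ _ t => t.graph

end CliqueExpr

/-- `G` is, up to isomorphism, the graph defined by an expression with `k` labels. -/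
def HasCliqueExpr {V : Type*} (k : ℕ) (G : SimpleGraph V) : Prop :=
  ∃ t : CliqueExpr k, Nonempty (t.graph ≃g G)

/-- `G` has cliquewidth at most `k`: every finite nonempty induced subgraph of `G` is defined by an
expression with `k` labels. For a finite nonempty graph this says that `G` itself is defined by an
expression with `k` labels, see `cliquewidthAtMost_iff_hasCliqueExpr`; the empty graph has
cliquewidth `0`. -/
def CliquewidthAtMost {V : Type*} (k : ℕ) (G : SimpleGraph V) : Prop :=
  ∀ S : Set V, S.Finite → S.Nonempty → HasCliqueExpr k (G.induce S)

/-- Expressions restrict to nonempty sets of vertices. -/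
theorem CliqueExpr.exists_restrict {k : ℕ} (t : CliqueExpr k) (S : Set t.Vert)
    (hS : S.Nonempty) :
    ∃ t' : CliqueExpr k, ∃ e : t'.graph ↪g t.graph,
      Set.range e = S ∧ ∀ v, t'.label v = t.label (e v) := by
  induction t with
  | vertex i =>
    refine ⟨vertex i, SimpleGraph.Embedding.refl, ?_, fun _ => rfl⟩
    obtain ⟨x, hx⟩ := hS
    ext y
    exact ⟨fun _ => hx, fun _ => ⟨y, rfl⟩⟩
  | union s t ihs iht =>
    by_cases h₁ : (Sum.inl ⁻¹' S : Set s.Vert).Nonempty <;>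
      by_cases h₂ : (Sum.inr ⁻¹' S : Set t.Vert).Nonempty
    · obtain ⟨s', e, he, hs⟩ := ihs _ h₁
      obtain ⟨t', f, hf, ht⟩ := iht _ h₂
      refine ⟨union s' t', ⟨⟨Sum.map e f, e.injective.sumMap f.injective⟩, ?_⟩, ?_, ?_⟩
      · rintro (a | a) (b | b)
        · exact e.map_rel_iff
        · exact Iff.rfl
        · exact Iff.rfl
        · exact f.map_rel_iff
      · ext x
        rcases x with x | x
        · have : x ∈ Set.range e ↔ Sum.inl x ∈ S := by rw [he]; rfl
          refine Iff.trans ?_ this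
          constructor
          · rintro ⟨a | a, ha⟩
            · exact ⟨a, Sum.inl_injective ha⟩
            · cases ha
          · rintro ⟨a, rfl⟩
            exact ⟨Sum.inl a, rfl⟩
        · have : x ∈ Set.range f ↔ Sum.inr x ∈ S := by rw [hf]; rfl
          refine Iff.trans ?_ this
          constructor
          · rintro ⟨a | a, ha⟩
            · cases ha
            · exact ⟨a, Sum.inr_injective ha⟩
          · rintro ⟨a, rfl⟩
            exact ⟨Sum.inr a, rfl⟩
      · rintro (a | a)
        · exact hs a
        · exact ht a
    · obtain ⟨s', e, he, hs⟩ := ihs _ h₁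
      refine ⟨s', ⟨⟨fun a => Sum.inl (e a), Sum.inl_injective.comp e.injective⟩,
        e.map_rel_iff⟩, ?_, hs⟩
      ext x
      rcases x with x | x
      · have : x ∈ Set.range e ↔ Sum.inl x ∈ S := by rw [he]; rfl
        refine Iff.trans ?_ this
        exact ⟨fun ⟨a, ha⟩ => ⟨a, Sum.inl_injective ha⟩, fun ⟨a, ha⟩ => ⟨a, congrArg Sum.inl ha⟩⟩
      · exact ⟨fun ⟨a, ha⟩ => (nomatch ha), fun hx => (h₂ ⟨x, hx⟩).elim⟩
    · obtain ⟨t', f, hf, ht⟩ := iht _ h₂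
      refine ⟨t', ⟨⟨fun a => Sum.inr (f a), Sum.inr_injective.comp f.injective⟩,
        f.map_rel_iff⟩, ?_, ht⟩
      ext x
      rcases x with x | x
      · exact ⟨fun ⟨a, ha⟩ => (nomatch ha), fun hx => (h₁ ⟨x, hx⟩).elim⟩
      · have : x ∈ Set.range f ↔ Sum.inr x ∈ S := by rw [hf]; rfl
        refine Iff.trans ?_ this
        exact ⟨fun ⟨a, ha⟩ => ⟨a, Sum.inr_injective ha⟩, fun ⟨a, ha⟩ => ⟨a, congrArg Sum.inr ha⟩⟩
    · obtain ⟨x | x, hx⟩ := hS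
      · exact (h₁ ⟨x, hx⟩).elim
      · exact (h₂ ⟨x, hx⟩).elim
  | join i j hij t ih =>
    obtain ⟨t', e, he, hl⟩ := ih S hS
    refine ⟨join i j hij t', ⟨e.toEmbedding, ?_⟩, he, hl⟩
    intro a b
    change (t.graph.Adj (e a) (e b) ∨ (t.label (e a) = i ∧ t.label (e b) = j) ∨
        (t.label (e a) = j ∧ t.label (e b) = i)) ↔
      (t'.graph.Adj a b ∨ (t'.label a = i ∧ t'.label b = j) ∨
        (t'.label a = j ∧ t'.label b = i))
    exact or_congr e.map_rel_iff (by
      have ha := hl a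
      have hb := hl b
      exact iff_of_eq (by rw [← ha, ← hb]))
  | relabel i j t ih =>
    obtain ⟨t', e, he, hl⟩ := ih S hS
    refine ⟨relabel i j t', e, he, fun v => ?_⟩
    change (if t'.label v = i then j else t'.label v) =
      if t.label (e v) = i then j else t.label (e v)
    rw [hl v]

/-- On finite nonempty graphs, `CliquewidthAtMost` is the usual notion. -/
theorem cliquewidthAtMost_iff_hasCliqueExpr {V : Type*} [Finite V] [Nonempty V] (k : ℕ)
    (G : SimpleGraph V) : CliquewidthAtMost k G ↔ HasCliqueExpr k G := by
  constructor
  · intro h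
    obtain ⟨t, ⟨e⟩⟩ := h Set.univ Set.finite_univ Set.univ_nonempty
    exact ⟨t, ⟨e.trans (SimpleGraph.induceUnivIso G)⟩⟩
  · rintro ⟨t, ⟨e⟩⟩ S _ hS
    obtain ⟨t', f, hf, -⟩ := t.exists_restrict (e ⁻¹' S) (hS.preimage e.surjective)
    have hmem : ∀ a, e (f a) ∈ S := fun a => by
      have : f a ∈ e ⁻¹' S := hf ▸ Set.mem_range_self a
      exact this
    refine ⟨t', ⟨⟨Equiv.ofBijective (fun a => (⟨e (f a), hmem a⟩ : S)) ⟨?_, ?_⟩, ?_⟩⟩⟩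
    · intro a b hab
      exact f.injective (e.injective (Subtype.ext_iff.mp hab))
    · rintro ⟨x, hx⟩
      have : e.symm x ∈ Set.range f := by
        rw [hf]
        simpa using hx
      obtain ⟨a, ha⟩ := this
      exact ⟨a, Subtype.ext (by simp [ha])⟩
    · intro a b
      exact e.map_rel_iff.trans f.map_rel_iff

/-! ### Graph classes -/

/-- A class of (possibly infinite) simple graphs, not necessarily closed under isomorphism. -/
abbrev GraphClass : Type (u + 1) := Set (Σ V : Type u, SimpleGraph V)

/-- A graph class has bounded cliquewidth. -/
def GraphClass.BoundedCliquewidth (C : GraphClass.{u}) : Prop :=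
  ∃ k : ℕ, ∀ (V : Type u) (G : SimpleGraph V), ⟨V, G⟩ ∈ C → CliquewidthAtMost k G

/-! ### Flips -/

/-- The flip of `G` for the partition of the vertices into the fibres of `c`, and the symmetric
relation `F` on the parts: the adjacency of two distinct vertices is complemented exactly if their
parts are related by `F`. -/
def SimpleGraph.flip {V ι : Type*} (G : SimpleGraph V) (c : V → ι) (F : ι → ι → Prop)
    (hF : ∀ i j, F i j → F j i) : SimpleGraph V where
  Adj u v := u ≠ v ∧ ((F (c u) (c v) ∧ ¬ G.Adj u v) ∨ (¬ F (c u) (c v) ∧ G.Adj u v))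
  symm := ⟨by
    rintro u v ⟨hne, ⟨h₁, h₂⟩ | ⟨h₁, h₂⟩⟩
    · exact ⟨hne.symm, Or.inl ⟨hF _ _ h₁, fun h => h₂ h.symm⟩⟩
    · exact ⟨hne.symm, Or.inr ⟨fun h => h₁ (hF _ _ h), h₂.symm⟩⟩⟩
  loopless := ⟨fun _ h => h.1 rfl⟩

/-- `H` is a `k`-flip of `G`: a flip for a partition of the vertex set into at most `k` parts
(some of the `k` fibres of the map `c` may be empty). -/
def IsKFlip {V : Type*} (k : ℕ) (G H : SimpleGraph V) : Prop :=
  ∃ (c : V → Fin k) (F : Fin k → Fin k → Prop) (hF : ∀ i j, F i j → F j i), H = G.flip c F hF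

/-- Distance-∞ flip-breakability. -/
def GraphClass.DistInftyFlipBreakable (C : GraphClass.{u}) : Prop :=
  ∃ (N : ℕ → ℕ) (k : ℕ), ∀ (m : ℕ) (V : Type u) (G : SimpleGraph V), ⟨V, G⟩ ∈ C →
    ∀ W : Set V, (N m : ℕ∞) ≤ W.encard →
      ∃ A B : Set V, A ⊆ W ∧ B ⊆ W ∧ (m : ℕ∞) ≤ A.encard ∧ (m : ℕ∞) ≤ B.encard ∧
        ∃ H : SimpleGraph V, IsKFlip k G H ∧
          ∀ a ∈ A, ∀ b ∈ B, H.connectedComponentMk a ≠ H.connectedComponentMk b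

/-! Both properties are equivalent to having cuts that are balanced on a given large set and across
which adjacency depends only on boundedly many colours.

From cliquewidth to flips: in an expression, vertices of a subexpression with equal labels have the
same neighbours outside it. Descending towards the larger part of `W` finds a subexpression
containing between one and two thirds of `W` (`CliqueExpr.hasBalancedCut`). Compactness extends this
to infinite graphs, and colouring the outer vertices by the labels they see gives a flip that
deletes all edges across the cut (`HomogeneousCut.exists_flip`).

From flips to cliquewidth: a flip separating `A` from `B` yields a cut of small rank. Vertex sets of
cut rank at most `N` are split recursively into two such sets (`IsCutBreakable.exists_split`). Below
rank `N` a single vertex is removed; at rank `N`, breaking a set of `N` independent rows produces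
two parts of smaller rank. A set of cut rank at most `N` has at most `2 ^ N` neighbourhood types
over `ZMod 2`, so labels recording these types suffice to rebuild the graph
(`ExpressibleOn.combine`). -/

/-! ### Balanced cuts from clique expressions -/

/-- A side `X` of a cut of `G` is `d`-homogeneous if vertices of `X` of the same colour have the
same neighbours outside of `X`. -/
def HomogeneousCut {V ι : Type*} (G : SimpleGraph V) (X : Set V) (d : V → ι) : Prop :=
  ∀ u ∈ X, ∀ u' ∈ X, d u = d u' → ∀ v ∉ X, G.Adj u v → G.Adj u' v

/-- A set `W` of vertices of a labelled graph has a part of size between `m` and `2 * m` which is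
cut out by a homogeneous cut refining the labelling. -/
def HasBalancedCut {V ι : Type*} (G : SimpleGraph V) (l : V → ι) (W : Set V) (m : ℕ) : Prop :=
  ∃ (X : Set V) (d : V → ι), (m : ℕ∞) ≤ (W ∩ X).encard ∧ (W ∩ X).encard ≤ 2 * (m : ℕ∞) ∧
    HomogeneousCut G X d ∧ ∀ u ∈ X, ∀ u' ∈ X, d u = d u' → l u = l u'

theorem HasBalancedCut.of_encard_le {V ι : Type*} (G : SimpleGraph V) (l : V → ι) {W : Set V}
    {m : ℕ} (h₁ : (m : ℕ∞) ≤ W.encard) (h₂ : W.encard ≤ 2 * (m : ℕ∞)) : HasBalancedCut G l W m :=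
  ⟨Set.univ, l, by simpa using h₁, by simpa using h₂,
    fun _ _ _ _ _ v hv => (hv trivial).elim, fun _ _ _ _ h => h⟩

/-- With no edges leaving the range of `f`, passing to the larger graph gives vertices of `X` no new
neighbours. This lifts a cut from one side of a disjoint union. -/
theorem HasBalancedCut.map {V U ι : Type*} {G : SimpleGraph V} {H : SimpleGraph U} {l : V → ι}
    {l' : U → ι} {f : V → U} {W : Set U} {m : ℕ} (h : HasBalancedCut G l (f ⁻¹' W) m)
    (hf : Function.Injective f) (hl : ∀ v, l' (f v) = l v)
    (hadj : ∀ u v, H.Adj (f u) (f v) ↔ G.Adj u v)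
    (hout : ∀ u, ∀ v ∉ Set.range f, ¬ H.Adj (f u) v) : HasBalancedCut H l' W m := by
  obtain ⟨X, d, hX₁, hX₂, hd, hdl⟩ := h
  have hWX : W ∩ f '' X = f '' (f ⁻¹' W ∩ X) := (Set.image_preimage_inter f X W).symm
  refine ⟨f '' X, Function.extend f d l', ?_, ?_, ?_, ?_⟩
  · rwa [hWX, hf.encard_image]
  · rwa [hWX, hf.encard_image]
  · rintro _ ⟨a, ha, rfl⟩ _ ⟨b, hb, rfl⟩ hab v hv huv
    obtain ⟨c, rfl⟩ : v ∈ Set.range f := by_contra fun h => hout a v h huv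
    rw [hf.extend_apply, hf.extend_apply] at hab
    rw [hadj] at huv ⊢
    exact hd a ha b hb hab c (fun h => hv ⟨c, h, rfl⟩) huv
  · rintro _ ⟨a, ha, rfl⟩ _ ⟨b, hb, rfl⟩ hab
    rw [hf.extend_apply, hf.extend_apply] at hab
    rw [hl, hl]
    exact hdl a ha b hb hab

/-- Every set of vertices of an expression has a balanced part, cut out by a subexpression. -/
theorem CliqueExpr.hasBalancedCut {k : ℕ} (t : CliqueExpr k) (W : Set t.Vert) (m : ℕ)
    (hm : 1 ≤ m) (hW : (m : ℕ∞) ≤ W.encard) : HasBalancedCut t.graph t.label W m := by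
  by_cases hW' : W.encard ≤ 2 * (m : ℕ∞)
  · exact .of_encard_le _ _ hW hW'
  induction t with
  | vertex i =>
    refine (hW' ?_).elim
    have h1 : W.encard ≤ 1 := Set.encard_le_one_iff.2 fun a b _ _ => rfl
    refine h1.trans ?_
    norm_cast
    omega
  | union s t ihs iht =>
    let f : s.Vert → (union s t).Vert := Sum.inl
    let g : t.Vert → (union s t).Vert := Sum.inr
    have hf : Function.Injective f := Sum.inl_injective
    have hg : Function.Injective g := Sum.inr_injective
    have hsum : W.encard ≤ (f ⁻¹' W).encard + (g ⁻¹' W).encard := by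
      rw [← hf.encard_image, ← hg.encard_image]
      refine (Set.encard_le_encard ?_).trans (Set.encard_union_le _ _)
      rintro (v | v) hv
      · exact Or.inl ⟨v, hv, rfl⟩
      · exact Or.inr ⟨v, hv, rfl⟩
    have hs : (m : ℕ∞) ≤ (f ⁻¹' W).encard → HasBalancedCut s.graph s.label (f ⁻¹' W) m := by
      intro h
      by_cases h' : (f ⁻¹' W).encard ≤ 2 * (m : ℕ∞)
      · exact .of_encard_le _ _ h h'
      · exact ihs _ h h'
    have ht : (m : ℕ∞) ≤ (g ⁻¹' W).encard → HasBalancedCut t.graph t.label (g ⁻¹' W) m := by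
      intro h
      by_cases h' : (g ⁻¹' W).encard ≤ 2 * (m : ℕ∞)
      · exact .of_encard_le _ _ h h'
      · exact iht _ h h'
    -- Two sides with fewer than `m` elements of `W` each would contradict `|W| > 2m`, so the
    -- descent can continue into one of them.
    by_cases h₁ : (m : ℕ∞) ≤ (f ⁻¹' W).encard
    · refine (hs h₁).map hf (fun _ => rfl) (fun _ _ => Iff.rfl) ?_
      rintro u (v | v) hv huv
      · exact hv ⟨v, rfl⟩
      · have huv' : (SimpleGraph.sum s.graph t.graph).Adj (Sum.inl u) (Sum.inr v) := huv
        simp at huv'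
    · have h₂ : (m : ℕ∞) ≤ (g ⁻¹' W).encard := by
        by_contra h₂
        apply hW'
        rw [two_mul]
        exact hsum.trans (add_le_add (not_le.1 h₁).le (not_le.1 h₂).le)
      refine (ht h₂).map hg (fun _ => rfl) (fun _ _ => Iff.rfl) ?_
      rintro u (v | v) hv huv
      · have huv' : (SimpleGraph.sum s.graph t.graph).Adj (Sum.inr u) (Sum.inl v) := huv
        simp at huv'
      · exact hv ⟨v, rfl⟩
  | join i j hij t ih =>
    obtain ⟨X, d, hX₁, hX₂, hd, hl⟩ := ih W hW hW'
    refine ⟨X, d, hX₁, hX₂, ?_, hl⟩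
    intro a ha b hb hab v hv huv
    -- This is why `d` must refine the labelling: later joins then treat equally coloured vertices
    -- of `X` alike.
    have hlab : t.label a = t.label b := hl a ha b hb hab
    rcases huv with h | ⟨h₁, h₂⟩ | ⟨h₁, h₂⟩
    · exact Or.inl (hd a ha b hb hab v hv h)
    · exact Or.inr (Or.inl ⟨hlab ▸ h₁, h₂⟩)
    · exact Or.inr (Or.inr ⟨hlab ▸ h₁, h₂⟩)
  | relabel i j t ih =>
    obtain ⟨X, d, hX₁, hX₂, hd, hl⟩ := ih W hW hW'
    refine ⟨X, d, hX₁, hX₂, hd, fun a ha b hb hab => ?_⟩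
    have hlab : t.label a = t.label b := hl a ha b hb hab
    change (if t.label a = i then j else t.label a) = if t.label b = i then j else t.label b
    rw [hlab]

/-- The balanced cuts of the finite induced subgraphs of a graph of bounded cliquewidth have a
limit. -/
theorem CliquewidthAtMost.exists_balanced_cut {V : Type*} {k m : ℕ} {G : SimpleGraph V}
    (hG : CliquewidthAtMost k G) (hm : 1 ≤ m) (W : Finset V) (hW : W.card = 3 * m) :
    ∃ (X : Set V) (d : V → Fin (k + 1)), (m : ℕ∞) ≤ (↑W ∩ X).encard ∧
      (m : ℕ∞) ≤ (↑W \ X).encard ∧ HomogeneousCut G X d := by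
  classical
  -- The extra colour `0` serves as a default value outside `S`, also when `k = 0`. The values lie
  -- in a finite type, as the selection lemma requires.
  have key : ∀ S : Finset V, ∃ g : V → Prop × Fin (k + 1), W ⊆ S →
      (m : ℕ∞) ≤ (↑W ∩ {v | (g v).1}).encard ∧ (↑W ∩ {v | (g v).1}).encard ≤ 2 * (m : ℕ∞) ∧
      ∀ u ∈ S, ∀ u' ∈ S, ∀ v ∈ S, (g u).1 → (g u').1 → (g u).2 = (g u').2 → ¬ (g v).1 →
        G.Adj u v → G.Adj u' v := by
    intro S
    by_cases hS : W ⊆ S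
    swap
    · exact ⟨fun _ => (True, 0), fun h => (hS h).elim⟩
    have hWne : W.Nonempty := by
      rw [← Finset.card_pos]
      omega
    obtain ⟨t, ⟨e⟩⟩ := hG S S.finite_toSet (by simpa using hWne.mono hS)
    set f : t.Vert → V := fun a => (e a : V) with hf
    have hfinj : Function.Injective f := Subtype.val_injective.comp e.injective
    have hfS : ∀ v ∈ S, ∃ a, f a = v := fun v hv => by
      obtain ⟨a, ha⟩ := e.surjective ⟨v, hv⟩
      exact ⟨a, by simp [hf, ha]⟩
    have hadj : ∀ a b, t.graph.Adj a b ↔ G.Adj (f a) (f b) := fun a b =>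
      (e.map_rel_iff (a := a) (b := b)).symm
    have hWim : f '' (f ⁻¹' (W : Set V)) = W :=
      Set.image_preimage_eq_of_subset fun v hv => hfS v (hS hv)
    have hWenc : (f ⁻¹' (W : Set V)).encard = (3 * m : ℕ) := by
      rw [← hfinj.encard_image, hWim, Set.encard_coe_eq_coe_finsetCard, hW]
    obtain ⟨X, d, h₁, h₂, hd, -⟩ := t.hasBalancedCut (f ⁻¹' W) m hm (by
      rw [hWenc]
      norm_cast
      omega)
    have hdf : ∀ a, Function.extend f (fun a => (d a).castSucc) (fun _ => 0) (f a) =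
      (d a).castSucc := fun a => hfinj.extend_apply _ _ a
    have hX : (W : Set V) ∩ f '' X = f '' (f ⁻¹' W ∩ X) :=
      (Set.image_preimage_inter f X W).symm
    refine ⟨fun v => (v ∈ f '' X, Function.extend f (fun a => (d a).castSucc) (fun _ => 0) v),
      fun _ => ⟨?_, ?_, ?_⟩⟩
    · change _ ≤ ((W : Set V) ∩ f '' X).encard
      rwa [hX, hfinj.encard_image]
    · change ((W : Set V) ∩ f '' X).encard ≤ _
      rwa [hX, hfinj.encard_image]
    · rintro _ _ _ _ v hv ⟨a, ha, rfl⟩ ⟨b, hb, rfl⟩ hab hvX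
      obtain ⟨c, rfl⟩ := hfS v hv
      simp only [hdf] at hab
      rw [← hadj, ← hadj]
      exact hd a ha b hb (Fin.castSucc_injective _ hab) c fun h => hvX ⟨c, h, rfl⟩
  choose g hg using key
  -- On each finite set, `χ` agrees with `g S` for some larger `S`. Homogeneity involves three
  -- vertices at a time and the size bounds only involve `W`, so both pass to the limit.
  obtain ⟨χ, hχ⟩ := Finset.rado_selection g
  refine ⟨{v | (χ v).1}, fun v => (χ v).2, ?_, ?_, ?_⟩
  rotate_right
  · intro u hu u' hu' huu v hv
    obtain ⟨S, hS, hχS⟩ := hχ (W ∪ {u, u', v})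
    have h₁ : u ∈ W ∪ {u, u', v} := by simp
    have h₂ : u' ∈ W ∪ {u, u', v} := by simp
    have h₃ : v ∈ W ∪ {u, u', v} := by simp
    have := (hg S (Finset.subset_union_left.trans hS)).2.2 u (hS h₁) u' (hS h₂) v (hS h₃)
    rw [← hχS u h₁, ← hχS u' h₂, ← hχS v h₃] at this
    exact this hu hu' huu hv
  all_goals
    obtain ⟨S, hS, hχS⟩ := hχ W
    obtain ⟨h₁, h₂, -⟩ := hg S hS
    have hE : (W : Set V) ∩ {v | (g S v).1} = ↑W ∩ {v | (χ v).1} := by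
      ext v
      exact and_congr_right fun hv => by
        change (g S v).1 ↔ (χ v).1
        rw [hχS v hv]
    rw [hE] at h₁ h₂
  · exact h₁
  · have hsum := Set.encard_sdiff_add_encard_inter (W : Set V) {v | (χ v).1}
    rw [Set.encard_coe_eq_coe_finsetCard, hW] at hsum
    by_contra hlt
    rw [not_le] at hlt
    have : ((3 * m : ℕ) : ℕ∞) < (3 * m : ℕ) := by
      calc ((3 * m : ℕ) : ℕ∞) = _ := hsum.symm
        _ < (m : ℕ∞) + 2 * (m : ℕ∞) :=
          ENat.add_lt_add_of_lt_of_le (W.finite_toSet.inter_of_left _).encard_lt_top.ne hlt h₂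
        _ = (3 * m : ℕ) := by push_cast; ring
    exact lt_irrefl _ this

/-! ### From homogeneous cuts to flips -/

/-- A homogeneous cut is disconnected by a flip. -/
theorem HomogeneousCut.exists_flip {V : Type*} {k : ℕ} {G : SimpleGraph V} {X : Set V}
    {d : V → Fin k} (h : HomogeneousCut G X d) :
    ∃ H : SimpleGraph V, IsKFlip (k + 2 ^ k) G H ∧
      ∀ a ∈ X, ∀ b ∉ X, H.connectedComponentMk a ≠ H.connectedComponentMk b := by
  classical
  let ε : Fin k ⊕ Finset (Fin k) ≃ Fin (k + 2 ^ k) := Fintype.equivFinOfCardEq (by simp)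
  -- A vertex outside `X` is coloured by the set of colours of its neighbours in `X`. By
  -- homogeneity, adjacency across the cut is exactly membership `i ∈ s`, which is what gets
  -- flipped.
  let c : V → Fin k ⊕ Finset (Fin k) := fun v => if v ∈ X then Sum.inl (d v) else
    Sum.inr (Finset.univ.filter fun i => ∃ u ∈ X, d u = i ∧ G.Adj u v)
  let R : Fin k ⊕ Finset (Fin k) → Fin k ⊕ Finset (Fin k) → Prop := fun p q =>
    ∃ i s, i ∈ s ∧ (p = Sum.inl i ∧ q = Sum.inr s ∨ p = Sum.inr s ∧ q = Sum.inl i)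
  let F : Fin (k + 2 ^ k) → Fin (k + 2 ^ k) → Prop := fun p q => R (ε.symm p) (ε.symm q)
  have hF : ∀ p q, F p q → F q p := by
    rintro p q ⟨i, s, his, h | h⟩
    · exact ⟨i, s, his, Or.inr h.symm⟩
    · exact ⟨i, s, his, Or.inl h.symm⟩
  have hFc : ∀ u ∈ X, ∀ v ∉ X, F (ε (c u)) (ε (c v)) ↔ G.Adj u v := by
    intro u hu v hv
    simp only [F, R, Equiv.symm_apply_apply, c, if_pos hu, if_neg hv]
    constructor
    · rintro ⟨i, s, his, ⟨h₁, h₂⟩ | ⟨h₁, h₂⟩⟩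
      · cases h₁
        cases h₂
        obtain ⟨u', hu', hd, hadj⟩ := (Finset.mem_filter.1 his).2
        exact h u' hu' u hu hd v hv hadj
      · cases h₁
    · intro huv
      exact ⟨_, _, Finset.mem_filter.2 ⟨Finset.mem_univ _, u, hu, rfl, huv⟩, Or.inl ⟨rfl, rfl⟩⟩
  refine ⟨G.flip (fun v => ε (c v)) F hF, ⟨_, F, hF, rfl⟩, fun a ha b hb hab => hb ?_⟩
  obtain ⟨p⟩ := SimpleGraph.ConnectedComponent.exact hab
  clear hab hb
  -- No edge of the flip crosses the cut, so a walk starting in `X` stays in `X`.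
  induction p with
  | nil => exact ha
  | @cons u v w huv p ih =>
    refine ih ?_
    by_contra hv
    have := hFc u ha v hv
    rcases huv.2 with h' | h'
    · exact h'.2 (this.1 h'.1)
    · exact h'.1 (this.2 h'.2)

theorem GraphClass.BoundedCliquewidth.distInftyFlipBreakable {C : GraphClass.{u}}
    (hC : C.BoundedCliquewidth) : C.DistInftyFlipBreakable := by
  obtain ⟨k, hk⟩ := hC
  -- The balanced cut is taken with `m + 1` because it needs a positive size.
  refine ⟨fun m => 3 * (m + 1), k + 1 + 2 ^ (k + 1), fun m V G hG W hW => ?_⟩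
  obtain ⟨W', hW', hcard⟩ := Set.exists_subset_encard_eq hW
  have hfin : W'.Finite := Set.finite_of_encard_eq_coe hcard
  obtain ⟨W', rfl⟩ := hfin.exists_finset_coe
  rw [Set.encard_coe_eq_coe_finsetCard] at hcard
  obtain ⟨X, d, h₁, h₂, hd⟩ :=
    (hk V G hG).exists_balanced_cut (m := m + 1) (by omega) W' (by exact_mod_cast hcard)
  obtain ⟨H, hH, hsep⟩ := hd.exists_flip
  have hle : (m : ℕ∞) ≤ (m + 1 : ℕ) := by norm_cast; omega
  exact ⟨_, _, Set.inter_subset_left.trans hW', Set.sdiff_subset.trans hW', hle.trans h₁,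
    hle.trans h₂, H, hH, fun a ha b hb => hsep a ha.2 b hb.2⟩

/-! ### Assembling clique expressions -/

/-- The subgraph of `G` induced by `S`, labelled by `l`, is defined by an expression with labels
`Λ`, numbered by `ε`. -/
def ExpressibleOn {V Λ : Type*} {k : ℕ} (ε : Λ ≃ Fin k) (G : SimpleGraph V) (S : Set V)
    (l : V → Λ) : Prop :=
  ∃ (t : CliqueExpr k) (e : t.Vert → V), Function.Injective e ∧ Set.range e = S ∧
    (∀ a b, t.graph.Adj a b ↔ G.Adj (e a) (e b)) ∧ ∀ a, t.label a = ε (l (e a))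

namespace ExpressibleOn

variable {V Λ : Type*} {k : ℕ} {ε : Λ ≃ Fin k} {G : SimpleGraph V} {S T : Set V} {l : V → Λ}

theorem congr {G' : SimpleGraph V} {l' : V → Λ} (h : ExpressibleOn ε G S l)
    (hG : ∀ u ∈ S, ∀ v ∈ S, G'.Adj u v ↔ G.Adj u v) (hl : ∀ v ∈ S, l' v = l v) :
    ExpressibleOn ε G' S l' := by
  obtain ⟨t, e, he, rfl, hadj, hlab⟩ := h
  exact ⟨t, e, he, rfl, fun a b => by rw [hadj, hG _ ⟨a, rfl⟩ _ ⟨b, rfl⟩],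
    fun a => by rw [hlab, hl _ ⟨a, rfl⟩]⟩

theorem singleton (ε : Λ ≃ Fin k) (G : SimpleGraph V) (v : V) (l : V → Λ) :
    ExpressibleOn ε G {v} l := by
  refine ⟨.vertex (ε (l v)), fun _ => v, fun _ _ _ => rfl, ?_, fun _ _ => ?_, fun _ => rfl⟩
  · ext x
    exact ⟨fun ⟨_, h⟩ => h.symm, fun h => ⟨(), h.symm⟩⟩
  · exact ⟨fun h => h.elim, fun h => (G.irrefl h).elim⟩

theorem relabel_single [DecidableEq Λ] (h : ExpressibleOn ε G S l) (i j : Λ) :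
    ExpressibleOn ε G S fun v => if l v = i then j else l v := by
  obtain ⟨t, e, he, rfl, hadj, hlab⟩ := h
  have key : ∀ a, (if t.label a = ε i then ε j else t.label a) =
      ε (if l (e a) = i then j else l (e a)) := fun a => by
    simp only [hlab, ε.apply_eq_iff_eq]
    split_ifs <;> rfl
  exact ⟨.relabel (ε i) (ε j) t, e, he, rfl, hadj, key⟩

/-- Labels can be changed simultaneously if no new label is changed again. -/
theorem relabel (h : ExpressibleOn ε G S l) (L : Finset Λ) (φ : Λ → Λ) (hφ : ∀ i ∈ L, φ i ∉ L)
    (hl : ∀ v ∈ S, l v ∈ L) : ExpressibleOn ε G S fun v => φ (l v) := by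
  classical
  -- The labels are changed one at a time; since `φ` leaves `L`, no vertex already changed is
  -- affected again.
  have key : ∀ M : Finset Λ, M ⊆ L →
      ExpressibleOn ε G S fun v => if l v ∈ M then φ (l v) else l v := by
    intro M
    induction M using Finset.induction_on with
    | empty => exact fun _ => h.congr (fun _ _ _ _ => Iff.rfl) fun _ _ => by simp
    | insert i M hi ih =>
      intro hM
      have hiL : i ∈ L := hM (Finset.mem_insert_self _ _)
      refine ((ih ((Finset.subset_insert _ _).trans hM)).relabel_single i (φ i)).congr
        (fun _ _ _ _ => Iff.rfl) fun v hv => ?_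
      have hne : φ (l v) ≠ i := fun h => hφ _ (hl v hv) (h ▸ hiL)
      by_cases h₁ : l v ∈ M
      · simp [h₁, hne]
      · by_cases h₂ : l v = i <;> simp [h₂, hi]
        simp [h₁, h₂]
  exact (key L subset_rfl).congr (fun _ _ _ _ => Iff.rfl) fun v hv => (if_pos (hl v hv)).symm

theorem union {G₁ G₂ : SimpleGraph V} (hS : ExpressibleOn ε G₁ S l) (hT : ExpressibleOn ε G₂ T l)
    (hST : Disjoint S T) (h₁ : ∀ u ∈ S, ∀ v ∈ S, G.Adj u v ↔ G₁.Adj u v)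
    (h₂ : ∀ u ∈ T, ∀ v ∈ T, G.Adj u v ↔ G₂.Adj u v)
    (h₁₂ : ∀ u ∈ S, ∀ v ∈ T, ¬ G.Adj u v) : ExpressibleOn ε G (S ∪ T) l := by
  obtain ⟨s, e, he, rfl, hadj, hlab⟩ := hS
  obtain ⟨t, f, hf, rfl, hadj', hlab'⟩ := hT
  refine ⟨.union s t, Sum.elim e f, he.sumElim hf fun a b hab => ?_, Set.Sum.elim_range e f,
    ?_, ?_⟩
  · exact Set.disjoint_left.1 hST ⟨a, rfl⟩ ⟨b, hab.symm⟩
  · rintro (a | a) (b | b)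
    · exact (hadj a b).trans (h₁ _ ⟨a, rfl⟩ _ ⟨b, rfl⟩).symm
    · refine iff_of_false (fun h => ?_) (h₁₂ _ ⟨a, rfl⟩ _ ⟨b, rfl⟩)
      have h' : (SimpleGraph.sum s.graph t.graph).Adj (Sum.inl a) (Sum.inr b) := h
      simp at h'
    · refine iff_of_false (fun h => ?_) fun h => h₁₂ _ ⟨b, rfl⟩ _ ⟨a, rfl⟩ h.symm
      have h' : (SimpleGraph.sum s.graph t.graph).Adj (Sum.inr a) (Sum.inl b) := h
      simp at h'
    · exact (hadj' a b).trans (h₂ _ ⟨a, rfl⟩ _ ⟨b, rfl⟩).symm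
  · rintro (a | a)
    · exact hlab a
    · exact hlab' a

/-- Joining all pairs of labels in a finite set. -/
theorem join (h : ExpressibleOn ε G S l) (P : Finset (Λ × Λ)) (hP : ∀ p ∈ P, p.1 ≠ p.2)
    {G' : SimpleGraph V} (hG' : ∀ u ∈ S, ∀ v ∈ S, G'.Adj u v ↔
      G.Adj u v ∨ (l u, l v) ∈ P ∨ (l v, l u) ∈ P) : ExpressibleOn ε G' S l := by
  classical
  induction P using Finset.induction_on generalizing G' with
  | empty => exact h.congr (fun u hu v hv => by simp [hG' u hu v hv]) fun _ _ => rfl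
  | insert p P hp ih =>
    have hne : ∀ q ∈ P, q.1 ≠ q.2 := fun q hq => hP q (Finset.mem_insert_of_mem hq)
    let H : SimpleGraph V :=
      { Adj := fun u v => G.Adj u v ∨ (l u, l v) ∈ P ∨ (l v, l u) ∈ P
        symm := ⟨fun u v h => h.imp (fun h => h.symm) Or.symm⟩
        loopless := ⟨fun u h => by
          rcases h with h | h | h
          · exact G.irrefl h
          · exact hne _ h rfl
          · exact hne _ h rfl⟩ }
    obtain ⟨t, e, he, rfl, hadj, hlab⟩ := ih hne (G' := H) fun _ _ _ _ => Iff.rfl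
    have key : ∀ a b, (t.graph.Adj a b ∨ (t.label a = ε p.1 ∧ t.label b = ε p.2) ∨
        (t.label a = ε p.2 ∧ t.label b = ε p.1)) ↔ G'.Adj (e a) (e b) := fun a b => by
      rw [hG' _ ⟨a, rfl⟩ _ ⟨b, rfl⟩, hadj, hlab, hlab]
      simp only [H, ε.apply_eq_iff_eq, Finset.mem_insert, Prod.ext_iff]
      tauto
    exact ⟨.join (ε p.1) (ε p.2) (fun h => hP p (Finset.mem_insert_self _ _) (ε.injective h)) t,
      e, he, rfl, key, hlab⟩

theorem hasCliqueExpr (h : ExpressibleOn ε G Set.univ l) : HasCliqueExpr k G := by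
  obtain ⟨t, e, he, hr, hadj, -⟩ := h
  exact ⟨t, ⟨⟨Equiv.ofBijective e ⟨he, Set.range_eq_univ.1 hr⟩, fun {a b} => (hadj a b).symm⟩⟩⟩

end ExpressibleOn

/-- Expressions for `S` and `T` whose labels determine the neighbourhoods outside of `S` and `T` can
be combined, provided that the labels also determine the new labels `ρ`. -/
theorem ExpressibleOn.combine {V : Type*} {n k : ℕ} {ε : Fin 3 × Fin n ≃ Fin k}
    {G : SimpleGraph V} {S T : Set V} {σ τ ρ : V → Fin n}
    (hS : ExpressibleOn ε G S fun v => (0, σ v)) (hT : ExpressibleOn ε G T fun v => (0, τ v))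
    (hST : Disjoint S T) (hσ : HomogeneousCut G S σ) (hτ : HomogeneousCut G T τ)
    (hσρ : ∀ u ∈ S, ∀ v ∈ S, σ u = σ v → ρ u = ρ v)
    (hτρ : ∀ u ∈ T, ∀ v ∈ T, τ u = τ v → ρ u = ρ v) :
    ExpressibleOn ε G (S ∪ T) fun v => (0, ρ v) := by
  classical
  have hTS : ∀ v ∈ T, v ∉ S := fun v hT hS => Set.disjoint_left.1 hST hS hT
  -- The first coordinate is a layer: moving `S` to layer `1` keeps its labels distinct from those
  -- of `T`.
  let l : V → Fin 3 × Fin n := fun v => if v ∈ S then (1, σ v) else (0, τ v)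
  have hlS : ∀ v ∈ S, l v = (1, σ v) := fun v hv => if_pos hv
  have hlT : ∀ v ∈ T, l v = (0, τ v) := fun v hv => if_neg (hTS v hv)
  have hS' : ExpressibleOn ε G S l :=
    (hS.relabel (Finset.univ.filter fun p => p.1 = 0) (fun p => (1, p.2)) (by simp)
      (by simp)).congr (fun _ _ _ _ => Iff.rfl) hlS
  have hT' : ExpressibleOn ε G T l := hT.congr (fun _ _ _ _ => Iff.rfl) hlT
  let H : SimpleGraph V :=
    { Adj := fun u v => G.Adj u v ∧ (u ∈ S ↔ v ∈ S)
      symm := ⟨fun u v h => ⟨h.1.symm, h.2.symm⟩⟩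
      loopless := ⟨fun u h => G.irrefl h.1⟩ }
  have hU : ExpressibleOn ε H (S ∪ T) l := by
    refine hS'.union hT' hST ?_ ?_ ?_
    · exact fun u hu v hv => and_iff_left (iff_of_true hu hv)
    · exact fun u hu v hv => and_iff_left (iff_of_false (hTS u hu) (hTS v hv))
    · exact fun u hu v hv h => hTS v hv (h.2.1 hu)
  have hJ : ExpressibleOn ε G (S ∪ T) l := by
    refine hU.join (Finset.univ.filter fun p =>
      ∃ u ∈ S, ∃ v ∈ T, p = (l u, l v) ∧ G.Adj u v) ?_ ?_
    · intro p hp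
      obtain ⟨u, hu, v, hv, rfl, -⟩ := (Finset.mem_filter.1 hp).2
      simp [hlS u hu, hlT v hv]
    -- One edge between two label classes forces all of them: `hσ` moves its end in `S`, then `hτ`
    -- its end in `T`. So the joins create no false edges.
    · have hcross : ∀ u ∈ S, ∀ v ∈ T, (∃ u' ∈ S, ∃ v' ∈ T, (l u, l v) = (l u', l v') ∧
          G.Adj u' v') → G.Adj u v := by
        rintro u hu v hv ⟨u', hu', v', hv', h, hadj⟩
        rw [hlS u hu, hlS u' hu', hlT v hv, hlT v' hv'] at h
        simp only [Prod.mk.injEq, true_and] at h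
        exact (hτ v' hv' v hv h.2.symm u (fun hT => hTS u hT hu)
          (hσ u' hu' u hu h.1.symm v' (hTS v' hv') hadj).symm).symm
      have hsame : ∀ u v, (l u, l v) ∈ (Finset.univ.filter fun p : (Fin 3 × Fin n) × _ =>
          ∃ u ∈ S, ∃ v ∈ T, p = (l u, l v) ∧ G.Adj u v) → u ∈ S ∧ v ∉ S := by
        intro u v h
        obtain ⟨u', hu', v', hv', h, -⟩ := (Finset.mem_filter.1 h).2
        rw [hlS u' hu', hlT v' hv', Prod.mk.injEq] at h
        constructor
        · by_contra hu
          simp [l, hu] at h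
        · intro hv
          simp [l, hv] at h
      intro u hu v hv
      constructor
      · intro h
        by_cases hu' : u ∈ S <;> by_cases hv' : v ∈ S
        · exact Or.inl ⟨h, iff_of_true hu' hv'⟩
        · exact Or.inr (Or.inl (Finset.mem_filter.2
            ⟨Finset.mem_univ _, u, hu', v, hv.resolve_left hv', rfl, h⟩))
        · exact Or.inr (Or.inr (Finset.mem_filter.2
            ⟨Finset.mem_univ _, v, hv', u, hu.resolve_left hu', rfl, h.symm⟩))
        · exact Or.inl ⟨h, iff_of_false hu' hv'⟩
      · rintro (h | h | h)
        · exact h.1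
        · have hs := hsame u v h
          exact hcross u hs.1 v (hv.resolve_left hs.2) (Finset.mem_filter.1 h).2
        · have hs := hsame v u h
          exact (hcross v hs.1 u (hu.resolve_left hs.2) (Finset.mem_filter.1 h).2).symm
  have hφ : ∃ φ : Fin 3 × Fin n → Fin n, ∀ v ∈ S ∪ T, φ (l v) = ρ v := by
    refine ⟨fun p => if h : ∃ v ∈ S ∪ T, l v = p then ρ h.choose else p.2, fun v hv => ?_⟩
    have h : ∃ u ∈ S ∪ T, l u = l v := ⟨v, hv, rfl⟩
    refine (dif_pos h).trans ?_
    obtain ⟨hu, huv⟩ := h.choose_spec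
    generalize h.choose = w at hu huv ⊢
    rcases hu with hu | hu <;> rcases hv with hv | hv
    · rw [hlS _ hu, hlS _ hv, Prod.mk.injEq] at huv
      exact hσρ _ hu _ hv huv.2
    · rw [hlS _ hu, hlT _ hv, Prod.mk.injEq] at huv
      exact absurd huv.1 (by simp)
    · rw [hlT _ hu, hlS _ hv, Prod.mk.injEq] at huv
      exact absurd huv.1 (by simp)
    · rw [hlT _ hu, hlT _ hv, Prod.mk.injEq] at huv
      exact hτρ _ hu _ hv huv.2
  obtain ⟨φ, hφ⟩ := hφ
  -- Layer `2` is an intermediate stop: `relabel` needs the new labels to avoid the old ones, and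
  -- layers `0` and `1` are both in use.
  have hR := hJ.relabel (Finset.univ.filter fun p => p.1 ≠ 2) (fun p => (2, φ p)) (by simp)
    (by rintro v -; by_cases hv : v ∈ S <;> simp [l, hv])
  refine (hR.relabel (Finset.univ.filter fun p => p.1 = 2) (fun p => (0, p.2)) (by simp)
    (by simp)).congr (fun _ _ _ _ => Iff.rfl) fun v hv => ?_
  simp only [hφ v hv]

/-! ### Cut rank over the two-element field -/

open Classical in
/-- The row of the vertex `u` in the adjacency matrix over `ZMod 2`, restricted to columns `Y`. -/
noncomputable def SimpleGraph.row {V : Type*} (G : SimpleGraph V) (Y : Set V) (u : V) :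
    V → ZMod 2 :=
  fun v => if v ∈ Y ∧ G.Adj u v then 1 else 0

/-- The rank over `ZMod 2` of the `A × Y` submatrix of the adjacency matrix. -/
noncomputable def SimpleGraph.cutRank {V : Type*} (G : SimpleGraph V) (A Y : Set V) : ℕ :=
  (G.row Y '' A).finrank (ZMod 2)

namespace SimpleGraph

variable {V : Type*} {G : SimpleGraph V} {A A' B Y Y' Z : Set V}

theorem row_union (h : Disjoint Y Y') (u : V) : G.row (Y ∪ Y') u = G.row Y u + G.row Y' u := by
  classical
  funext v
  have := fun h₁ : v ∈ Y => Set.disjoint_left.1 h h₁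
  simp only [row, Pi.add_apply, Set.mem_union]
  by_cases h₁ : v ∈ Y <;> by_cases h₂ : v ∈ Y' <;> by_cases h₃ : G.Adj u v <;> simp_all

theorem row_eq_row_iff {u v : V} : G.row Y u = G.row Y v ↔ ∀ w ∈ Y, G.Adj u w ↔ G.Adj v w := by
  classical
  constructor
  · intro h w hw
    have := congrFun h w
    by_cases h₁ : G.Adj u w <;> by_cases h₂ : G.Adj v w <;> simp_all [row]
  · intro h
    funext w
    by_cases hw : w ∈ Y
    · simp [row, hw, h w hw]
    · simp [row, hw]

theorem cutRank_singleton_right_le (A : Set V) (v : V) : G.cutRank A {v} ≤ 1 := by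
  classical
  have h : Submodule.span (ZMod 2) (G.row {v} '' A) ≤
      Submodule.span (ZMod 2) {Pi.single v (1 : ZMod 2)} := by
    refine Submodule.span_le.2 ?_
    rintro _ ⟨u, -, rfl⟩
    refine Submodule.mem_span_singleton.2 ⟨if G.Adj u v then 1 else 0, ?_⟩
    funext w
    by_cases hw : w = v
    · subst hw
      simp [row]
    · simp [row, hw]
  have h' := finrank_span_le_card (R := ZMod 2) ({Pi.single v (1 : ZMod 2)} : Set (V → ZMod 2))
  rw [Set.toFinset_singleton, Finset.card_singleton] at h'
  exact (Submodule.finrank_mono h).trans h'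

variable [Finite V]

theorem cutRank_mono_left (h : A ⊆ A') : G.cutRank A Y ≤ G.cutRank A' Y :=
  Set.finrank_mono (Set.image_mono h)

theorem finrank_le_finrank_add {s t : Set (V → ZMod 2)} {w : Set (V → ZMod 2)}
    (h : ∀ x ∈ s, ∃ y ∈ Submodule.span (ZMod 2) t, ∃ z ∈ Submodule.span (ZMod 2) w, x = y + z) :
    s.finrank (ZMod 2) ≤ t.finrank (ZMod 2) + w.finrank (ZMod 2) := by
  refine (Submodule.finrank_mono (Submodule.span_le.2 ?_)).trans
    (Submodule.finrank_add_le_finrank_add_finrank _ _)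
  intro x hx
  obtain ⟨y, hy, z, hz, rfl⟩ := h x hx
  exact Submodule.add_mem_sup hy hz

theorem cutRank_union_right_le (h : Disjoint Y Y') :
    G.cutRank A (Y ∪ Y') ≤ G.cutRank A Y + G.cutRank A Y' := by
  refine finrank_le_finrank_add ?_
  rintro _ ⟨u, hu, rfl⟩
  exact ⟨_, Submodule.subset_span ⟨u, hu, rfl⟩, _, Submodule.subset_span ⟨u, hu, rfl⟩,
    row_union h u⟩

theorem cutRank_le_ncard : G.cutRank A Y ≤ A.ncard := by
  classical
  have := Fintype.ofFinite V
  rw [Set.ncard_eq_toFinset_card']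
  have h := finrank_span_finset_le_card (R := ZMod 2) (A.toFinset.image (G.row Y))
  rw [Finset.coe_image, Set.coe_toFinset] at h
  exact h.trans Finset.card_image_le

theorem cutRank_insert_right_le (v : V) : G.cutRank A (insert v Y) ≤ G.cutRank A Y + 1 := by
  by_cases hv : v ∈ Y
  · rw [Set.insert_eq_of_mem hv]
    exact Nat.le_succ _
  · have h₁ := cutRank_union_right_le (G := G) (A := A) (Set.disjoint_singleton_right.2 hv)
    have h₂ := cutRank_singleton_right_le (G := G) A v
    rw [Set.insert_eq, Set.union_comm]
    exact h₁.trans (Nat.add_le_add_left h₂ _)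

/-- A block matrix whose off-diagonal blocks have small rank has large rank. -/
theorem cutRank_add_cutRank_le (hY : Disjoint Y Y') :
    G.cutRank A Y + G.cutRank A' Y' ≤
      G.cutRank (A ∪ A') (Y ∪ Y') + (G.cutRank A Y' + G.cutRank A' Y) := by
  classical
  let R := ZMod 2
  have hzero : ∀ (A Y : Set V), ∀ x ∈ Submodule.span R (G.row Y '' A), ∀ v ∉ Y, x v = 0 := by
    intro A Y x hx v hv
    have h : Submodule.span R (G.row Y '' A) ≤ LinearMap.ker (LinearMap.proj (R := R) v) := by
      refine Submodule.span_le.2 ?_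
      rintro _ ⟨u, -, rfl⟩
      simp [row, hv]
    simpa using h hx
  -- The two diagonal row spaces have disjoint supports, so their dimensions add up. Each lies in
  -- the full row space plus an off-diagonal one.
  have hdisj : Submodule.span R (G.row Y '' A) ⊓ Submodule.span R (G.row Y' '' A') = ⊥ := by
    refine (Submodule.eq_bot_iff _).2 fun x hx => funext fun v => ?_
    by_cases hv : v ∈ Y
    · exact hzero A' Y' x hx.2 v (Set.disjoint_left.1 hY hv)
    · exact hzero A Y x hx.1 v hv
  have hsum := Submodule.finrank_sup_add_finrank_inf_eq (Submodule.span R (G.row Y '' A))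
    (Submodule.span R (G.row Y' '' A'))
  rw [hdisj, finrank_bot, add_zero] at hsum
  refine hsum.ge.trans (le_trans ?_ ((Submodule.finrank_add_le_finrank_add_finrank
    (Submodule.span R (G.row (Y ∪ Y') '' (A ∪ A')))
    (Submodule.span R (G.row Y' '' A) ⊔ Submodule.span R (G.row Y '' A'))).trans
    (Nat.add_le_add_left (Submodule.finrank_add_le_finrank_add_finrank _ _) _)))
  refine Submodule.finrank_mono (sup_le (Submodule.span_le.2 ?_) (Submodule.span_le.2 ?_))
  · rintro _ ⟨u, hu, rfl⟩
    have h : G.row Y u = G.row (Y ∪ Y') u + -G.row Y' u := by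
      rw [row_union hY]
      abel
    rw [h]
    exact Submodule.add_mem_sup (Submodule.subset_span ⟨u, Or.inl hu, rfl⟩)
      (Submodule.mem_sup_left (neg_mem (Submodule.subset_span ⟨u, hu, rfl⟩)))
  · rintro _ ⟨u, hu, rfl⟩
    have h : G.row Y' u = G.row (Y ∪ Y') u + -G.row Y u := by
      rw [row_union hY]
      abel
    rw [h]
    exact Submodule.add_mem_sup (Submodule.subset_span ⟨u, Or.inr hu, rfl⟩)
      (Submodule.mem_sup_right (neg_mem (Submodule.subset_span ⟨u, hu, rfl⟩)))

/-- One representative per colour already realises every row. -/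
theorem cutRank_le_of_coloring {k : ℕ} (c : V → Fin k)
    (h : ∀ u ∈ A, ∀ u' ∈ A, c u = c u' → ∀ v ∈ Y, G.Adj u v ↔ G.Adj u' v) :
    G.cutRank A Y ≤ k := by
  classical
  rcases A.eq_empty_or_nonempty with rfl | ⟨a, ha⟩
  · exact cutRank_le_ncard.trans (by simp)
  let f : Fin k → V := fun i => if h : ∃ u ∈ A, c u = i then h.choose else a
  have hf : ∀ u ∈ A, f (c u) ∈ A ∧ c (f (c u)) = c u := by
    intro u hu
    have h : ∃ v ∈ A, c v = c u := ⟨u, hu, rfl⟩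
    simp only [f, dif_pos h]
    exact h.choose_spec
  have hsub : G.row Y '' A ⊆ Set.range fun i => G.row Y (f i) := by
    rintro _ ⟨u, hu, rfl⟩
    exact ⟨c u, row_eq_row_iff.2 (h _ (hf u hu).1 u hu (hf u hu).2)⟩
  refine (Set.finrank_mono hsub).trans ?_
  simpa using finrank_range_le_card (R := ZMod 2) fun i => G.row Y (f i)

/-- A maximal set of independent rows. -/
theorem exists_independent_rows (A Y : Set V) :
    ∃ X ⊆ A, X.ncard = G.cutRank A Y ∧ ∀ X' ⊆ X, G.cutRank X' Y = X'.ncard := by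
  classical
  have := Fintype.ofFinite V
  obtain ⟨X, hX, -, hspan, hind⟩ :=
    exists_linearIndepOn_extension (linearIndepOn_empty (ZMod 2) (G.row Y)) (Set.empty_subset A)
  have hcard : ∀ X' ⊆ X, G.cutRank X' Y = X'.ncard := by
    intro X' hX'
    have h := finrank_span_eq_card (hind.mono hX')
    rw [← Set.image_eq_range] at h
    rw [Set.ncard_eq_toFinset_card', Set.toFinset_card]
    exact h
  refine ⟨X, hX, ?_, hcard⟩
  rw [← hcard X subset_rfl]
  exact (cutRank_mono_left hX).antisymm (Submodule.finrank_mono (Submodule.span_le.2 hspan))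

/-- Colouring the vertices by their rows uses few colours. -/
theorem exists_coloring_of_cutRank_le {n : ℕ} (h : G.cutRank A Y ≤ n) :
    ∃ τ : V → Fin (2 ^ n), ∀ u ∈ A, ∀ v ∈ A, τ u = τ v ↔ G.row Y u = G.row Y v := by
  classical
  have := Fintype.ofFinite V
  let M := Submodule.span (ZMod 2) (G.row Y '' A)
  -- Finiteness of the field matters here: a space of dimension at most `n` over `ZMod 2` has at
  -- most `2 ^ n` vectors.
  have hcard : Fintype.card M ≤ Fintype.card (Fin (2 ^ n)) := by
    rw [Module.card_eq_pow_finrank (K := ZMod 2) (V := M), ZMod.card, Fintype.card_fin]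
    exact Nat.pow_le_pow_right (by norm_num) h
  obtain ⟨f⟩ := Function.Embedding.nonempty_of_card_le hcard
  refine ⟨fun u => if h : G.row Y u ∈ M then f ⟨_, h⟩ else f 0, fun u hu v hv => ?_⟩
  have hu' : G.row Y u ∈ M := Submodule.subset_span ⟨u, hu, rfl⟩
  have hv' : G.row Y v ∈ M := Submodule.subset_span ⟨v, hv, rfl⟩
  simp [hu', hv']

end SimpleGraph

theorem HomogeneousCut.cutRank_le {V : Type*} [Finite V] {k : ℕ} {G : SimpleGraph V}
    {Z A Y : Set V} {c : V → Fin k} (h : HomogeneousCut G Z c) (hA : A ⊆ Z) (hY : Y ⊆ Zᶜ) :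
    G.cutRank A Y ≤ k :=
  SimpleGraph.cutRank_le_of_coloring c fun u hu u' hu' huu v hv =>
    ⟨h u (hA hu) u' (hA hu') huu v (hY hv), h u' (hA hu') u (hA hu) huu.symm v (hY hv)⟩

/-- A cut `Z` of small rank that leaves out many independent rows of the cut `B` splits off a part
of `B` of smaller cut rank. -/
theorem SimpleGraph.cutRank_inter_add_le {V : Type*} [Finite V] {k : ℕ} {G : SimpleGraph V}
    {B Z X : Set V} {c : V → Fin k} (h₁ : HomogeneousCut G Z c) (h₂ : HomogeneousCut G Zᶜ c)
    (hXB : X ⊆ B) (hX : ∀ X' ⊆ X, G.cutRank X' Bᶜ = X'.ncard) :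
    G.cutRank (B ∩ Z) (B ∩ Z)ᶜ + (X \ Z).ncard ≤ G.cutRank B Bᶜ + 4 * k := by
  have e₁ : (B ∩ Z)ᶜ = (Bᶜ ∩ Z) ∪ Zᶜ := by
    ext v
    by_cases hB : v ∈ B <;> by_cases hZ : v ∈ Z <;> simp [hB, hZ]
  have e₂ : Bᶜ = (Bᶜ ∩ Z) ∪ (Bᶜ \ Z) := (Set.inter_union_sdiff Bᶜ Z).symm
  have d₂ : Disjoint (Bᶜ ∩ Z) (Bᶜ \ Z) := Set.disjoint_sdiff_inter.symm
  -- The sets `B` and `Z` divide the vertices into four blocks, and every block crossing `Z` has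
  -- rank at most `k`. Dropping such blocks costs `k` in `a₁`, `2k` in `a₂` (the off-diagonal
  -- blocks) and `k` in `a₃`, in total `4k`.
  have a₁ : G.cutRank (B ∩ Z) (B ∩ Z)ᶜ ≤ G.cutRank (B ∩ Z) (Bᶜ ∩ Z) + k := by
    rw [e₁]
    refine (cutRank_union_right_le ?_).trans
      (Nat.add_le_add_left (h₁.cutRank_le Set.inter_subset_right subset_rfl) _)
    exact Set.disjoint_left.2 fun v hv hv' => hv' hv.2
  have a₂ : G.cutRank (B ∩ Z) (Bᶜ ∩ Z) + G.cutRank (B \ Z) (Bᶜ \ Z) ≤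
      G.cutRank B Bᶜ + (k + k) := by
    have h := cutRank_add_cutRank_le (G := G) (A := B ∩ Z) (A' := B \ Z) d₂
    rw [← e₂, Set.inter_union_sdiff] at h
    refine h.trans (Nat.add_le_add_left (Nat.add_le_add ?_ ?_) _)
    · exact h₁.cutRank_le Set.inter_subset_right fun v hv => hv.2
    · exact h₂.cutRank_le (fun v hv => hv.2) fun v hv => not_not_intro hv.2
  have a₃ : (X \ Z).ncard ≤ k + G.cutRank (B \ Z) (Bᶜ \ Z) := by
    rw [← hX _ Set.sdiff_subset]
    refine (cutRank_mono_left (Set.sdiff_subset_sdiff_left hXB)).trans ?_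
    conv_lhs => rw [e₂]
    refine (cutRank_union_right_le d₂).trans (Nat.add_le_add_right ?_ _)
    exact h₂.cutRank_le (fun v hv => hv.2) fun v hv => not_not_intro hv.2
  omega

/-! ### Recursive decomposition into sets of bounded cut rank -/

/-- Every large set `W` of vertices has at least `m` vertices on both sides of some cut which is
homogeneous with respect to `k` colours. -/
def IsCutBreakable {V : Type*} (G : SimpleGraph V) (N m k : ℕ) : Prop :=
  ∀ W : Set V, N ≤ W.ncard → ∃ (Z : Set V) (c : V → Fin k), m ≤ (W ∩ Z).ncard ∧
    m ≤ (W \ Z).ncard ∧ HomogeneousCut G Z c ∧ HomogeneousCut G Zᶜ c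

namespace IsCutBreakable

variable {V : Type*} [Finite V] {G : SimpleGraph V} {N k : ℕ}

/-- Below rank `N` there is room to remove one vertex, which raises the rank by at most one. At rank
`N` the `N` independent rows form a set large enough to be broken. -/
theorem exists_split (h : IsCutBreakable G N (4 * k + 1) k) (hN : 1 ≤ N) {B : Set V}
    (hB : G.cutRank B Bᶜ ≤ N) (hB' : B.Nontrivial) :
    ∃ S T : Set V, S.Nonempty ∧ T.Nonempty ∧ Disjoint S T ∧ S ∪ T = B ∧
      G.cutRank S Sᶜ ≤ N ∧ G.cutRank T Tᶜ ≤ N := by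
  rcases hB.lt_or_eq with hlt | heq
  · obtain ⟨v, hv, w, hw, hvw⟩ := hB'
    refine ⟨{v}, B \ {v}, Set.singleton_nonempty v, ⟨w, hw, hvw.symm⟩, Set.disjoint_sdiff_right,
      Set.union_sdiff_cancel (by simpa using hv), ?_, ?_⟩
    · exact SimpleGraph.cutRank_le_ncard.trans (by simpa using hN)
    · have e : (B \ {v})ᶜ = insert v Bᶜ := by
        ext x
        simp only [Set.mem_compl_iff, Set.mem_sdiff, Set.mem_singleton_iff, Set.mem_insert_iff]
        tauto
      rw [e]
      have h₁ := SimpleGraph.cutRank_insert_right_le (G := G) (A := B \ {v}) (Y := Bᶜ) v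
      have h₂ := SimpleGraph.cutRank_mono_left (G := G) (Y := Bᶜ)
        (Set.sdiff_subset : B \ {v} ⊆ B)
      omega
  · obtain ⟨X, hXB, hcard, hX⟩ := SimpleGraph.exists_independent_rows (G := G) B Bᶜ
    obtain ⟨Z, c, h₁, h₂, hZ, hZ'⟩ := h X (by omega)
    -- Each side of `Z` contains at least `4k + 1` elements of `X`, which outweighs the error `4k`;
    -- hence both parts have rank below `N`.
    have k₁ := SimpleGraph.cutRank_inter_add_le hZ hZ' hXB hX
    have k₂ := SimpleGraph.cutRank_inter_add_le (Z := Zᶜ) hZ' (by rwa [compl_compl]) hXB hX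
    rw [Set.sdiff_compl, ← Set.sdiff_eq] at k₂
    have n₁ : (X ∩ Z).Nonempty := Set.nonempty_of_ncard_ne_zero (by omega)
    have n₂ : (X \ Z).Nonempty := Set.nonempty_of_ncard_ne_zero (by omega)
    refine ⟨B ∩ Z, B \ Z, n₁.mono (Set.inter_subset_inter_left _ hXB),
      n₂.mono (Set.sdiff_subset_sdiff_left hXB), Set.disjoint_sdiff_inter.symm,
      Set.inter_union_sdiff B Z, by omega, by omega⟩

/-- Labels stand for exactly the neighbourhood types outside `B`. Equal labels giving equal rows
makes the parts homogeneous; the converse makes the labels of `S ∪ T` computable from those of the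
parts, as a row outside `S` determines the row outside `S ∪ T`. -/
theorem expressibleOn (h : IsCutBreakable G N (4 * k + 1) k) (hN : 1 ≤ N) (B : Set V)
    (hne : B.Nonempty) (hB : G.cutRank B Bᶜ ≤ N) :
    ∀ τ : V → Fin (2 ^ N), (∀ u ∈ B, ∀ v ∈ B, τ u = τ v ↔ G.row Bᶜ u = G.row Bᶜ v) →
      ExpressibleOn finProdFinEquiv G B fun v => ((0 : Fin 3), τ v) := by
  induction hn : B.ncard using Nat.strong_induction_on generalizing B with
  | _ n ih =>
    subst hn
    intro ρ hρ
    rcases hne.exists_eq_singleton_or_nontrivial with ⟨v, rfl⟩ | hnt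
    · exact ExpressibleOn.singleton _ _ _ _
    obtain ⟨S, T, hS, hT, hST, rfl, hSN, hTN⟩ := h.exists_split hN hB hnt
    obtain ⟨σ, hσ⟩ := SimpleGraph.exists_coloring_of_cutRank_le hSN
    obtain ⟨τ, hτ⟩ := SimpleGraph.exists_coloring_of_cutRank_le hTN
    have hcard := Set.ncard_union_eq hST
    have hS' := (Set.ncard_pos (s := S)).2 hS
    have hT' := (Set.ncard_pos (s := T)).2 hT
    refine (ih _ (by omega) S hS hSN rfl σ hσ).combine (ih _ (by omega) T hT hTN rfl τ hτ) hST
      ?_ ?_ ?_ ?_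
    · exact fun u hu v hv huv w hw =>
        (SimpleGraph.row_eq_row_iff.1 ((hσ u hu v hv).1 huv) w hw).1
    · exact fun u hu v hv huv w hw =>
        (SimpleGraph.row_eq_row_iff.1 ((hτ u hu v hv).1 huv) w hw).1
    · exact fun u hu v hv huv => (hρ u (Or.inl hu) v (Or.inl hv)).2 <|
        SimpleGraph.row_eq_row_iff.2 fun w hw => SimpleGraph.row_eq_row_iff.1
          ((hσ u hu v hv).1 huv) w fun hw' => hw (Or.inl hw')
    · exact fun u hu v hv huv => (hρ u (Or.inr hu) v (Or.inr hv)).2 <|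
        SimpleGraph.row_eq_row_iff.2 fun w hw => SimpleGraph.row_eq_row_iff.1
          ((hτ u hu v hv).1 huv) w fun hw' => hw (Or.inr hw')

theorem hasCliqueExpr [Nonempty V] (h : IsCutBreakable G N (4 * k + 1) k) (hN : 1 ≤ N) :
    HasCliqueExpr (3 * 2 ^ N) G := by
  have hzero : G.cutRank Set.univ (Set.univ)ᶜ ≤ N :=
    (SimpleGraph.cutRank_le_of_coloring (k := 1) (fun _ => 0) (by simp)).trans hN
  obtain ⟨τ, hτ⟩ := SimpleGraph.exists_coloring_of_cutRank_le hzero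
  exact (h.expressibleOn hN Set.univ Set.univ_nonempty hzero τ hτ).hasCliqueExpr

end IsCutBreakable

/-! ### From flips back to bounded cliquewidth -/

/-- A flip which separates `A` from `B` gives a homogeneous cut. -/
theorem IsKFlip.exists_homogeneousCut {V : Type*} {k : ℕ} {G H : SimpleGraph V} {A B : Set V}
    (hH : IsKFlip k G H)
    (hAB : ∀ a ∈ A, ∀ b ∈ B, H.connectedComponentMk a ≠ H.connectedComponentMk b) :
    ∃ (Z : Set V) (c : V → Fin k), A ⊆ Z ∧ Disjoint B Z ∧ HomogeneousCut G Z c ∧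
      HomogeneousCut G Zᶜ c := by
  obtain ⟨c, F, hF, rfl⟩ := hH
  set H := G.flip c F hF
  -- `Z` is the union of the components meeting `A`. Since `H` has no edge across it, adjacency in
  -- `G` across it must coincide with `F`.
  let Z : Set V := {v | ∃ a ∈ A, H.connectedComponentMk a = H.connectedComponentMk v}
  have hadj : ∀ u v, u ∈ Z → v ∉ Z → (G.Adj u v ↔ F (c u) (c v)) := by
    rintro u v ⟨a, ha, hau⟩ hv
    have huv : ¬ H.Adj u v := fun h =>
      hv ⟨a, ha, hau.trans (SimpleGraph.ConnectedComponent.connectedComponentMk_eq_of_adj h)⟩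
    have hne : u ≠ v := by
      rintro rfl
      exact hv ⟨a, ha, hau⟩
    have h' : ¬ (u ≠ v ∧ ((F (c u) (c v) ∧ ¬ G.Adj u v) ∨ (¬ F (c u) (c v) ∧ G.Adj u v))) := huv
    tauto
  refine ⟨Z, c, fun a ha => ⟨a, ha, rfl⟩, ?_, ?_, ?_⟩
  · exact Set.disjoint_left.2 fun b hb ⟨a, ha, hab⟩ => hAB a ha b hb hab
  · intro u hu u' hu' huu v hv h
    rw [hadj u v hu hv] at h
    rwa [hadj u' v hu' hv, ← huu]
  · intro u hu u' hu' huu v hv h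
    have hv' : v ∈ Z := not_not.1 hv
    rw [SimpleGraph.adj_comm, hadj v u hv' hu] at h
    rwa [SimpleGraph.adj_comm, hadj v u' hv' hu', ← huu]

theorem GraphClass.DistInftyFlipBreakable.boundedCliquewidth {C : GraphClass.{u}}
    (hC : C.DistInftyFlipBreakable) : C.BoundedCliquewidth := by
  obtain ⟨N, k, h⟩ := hC
  -- The added `1` makes the rank bound positive. Breakability is applied in all of `G` to subsets
  -- of `S`, and the resulting cuts are restricted to `S`.
  refine ⟨3 * 2 ^ (N (4 * k + 1) + 1), fun V G hG S hS hSne => ?_⟩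
  have := hS.to_subtype
  have := hSne.to_subtype
  refine IsCutBreakable.hasCliqueExpr (k := k) (fun W hW => ?_) (by omega)
  have hval : Function.Injective (Subtype.val : S → V) := Subtype.val_injective
  obtain ⟨A, B, hA, hB, hmA, hmB, H, hH, hAB⟩ := h (4 * k + 1) V G hG (Subtype.val '' W) (by
    rw [hval.encard_image, ← W.toFinite.cast_ncard_eq]
    exact_mod_cast (Nat.le_succ _).trans hW)
  obtain ⟨Z, c, hAZ, hBZ, hZ, hZ'⟩ := hH.exists_homogeneousCut hAB
  have hle : ∀ (D : Set V) (W' : Set S), D ⊆ Subtype.val '' W' → ((4 * k + 1 : ℕ) : ℕ∞) ≤ D.encard →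
      4 * k + 1 ≤ W'.ncard := by
    intro D W' hD hm
    have := hm.trans (Set.encard_le_encard hD)
    rw [hval.encard_image, ← W'.toFinite.cast_ncard_eq] at this
    exact_mod_cast this
  refine ⟨Subtype.val ⁻¹' Z, fun v => c v, hle A _ ?_ hmA, hle B _ ?_ hmB, ?_, ?_⟩
  · intro a ha
    obtain ⟨w, hw, rfl⟩ := hA ha
    exact ⟨w, ⟨hw, hAZ ha⟩, rfl⟩
  · intro b hb
    obtain ⟨w, hw, rfl⟩ := hB hb
    exact ⟨w, ⟨hw, Set.disjoint_left.1 hBZ hb⟩, rfl⟩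
  · exact fun u hu u' hu' huu v hv huv => hZ u hu u' hu' huu v hv huv
  · exact fun u hu u' hu' huu v hv huv => hZ' u hu u' hu' huu v hv huv

theorem mainTheorem11 (C : GraphClass.{u}) :
    C.BoundedCliquewidth ↔ C.DistInftyFlipBreakable :=
  ⟨fun h => h.distInftyFlipBreakable, fun h => h.boundedCliquewidth⟩
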